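/- Let $(R,\mathfrak m)$ be a countable commutative Noetherian local ring of Krull dimension at least $2$, with $\mathfrak m$-adic completion $\widehat R$. Call a finitely generated $\widehat R$-module $N$ extended if $N\cong\widehat R\otimes_R M$ for some $R$-module $M$. Then: (1) there are only countably many isomorphism classes of finitely generated $R$-modules; (2) there are uncountably many isomorphism classes of indecomposable finitely generated $\widehat R$-modules; (3) there are only countably many isomorphism classes of indecomposable $\widehat R$-modules that are isomorphic to direct summands of finitely generated extended $\widehat R$-modules; (4) there is a finitely generated $\widehat R$-module that is not isomorphic to a direct summand of any finitely generated extended $\widehat R$-module. -/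

import Mathlib

universe u

/-- The set of isomorphism classes of the `A`-modules that satisfy `P`. -/
def isoClassesOf (A : Type u) [CommRing A] (P : ModuleCat.{u} A → Prop) :
    Set (Quotient (CategoryTheory.isIsomorphicSetoid (ModuleCat.{u} A))) :=
  {c | ∃ N : ModuleCat.{u} A, P N ∧ c = Quotient.mk _ N}

/-- An `S`-module `N` is extended (from `R`) if it is isomorphic to `S ⊗ M` for some
`R`-module `M`. -/
def IsExtendedModule (R : Type u) [CommRing R] (S : Type u) [CommRing S] [Algebra R S]
    (N : Type u) [AddCommGroup N] [Module S N] : Prop :=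
  ∃ (M : Type u) (_ : AddCommGroup M) (_ : Module R M),
    Nonempty (TensorProduct R S M ≃ₗ[S] N)

/-- `N` is isomorphic to a direct summand of `L`. -/
def IsoToDirectSummand (A : Type u) [CommRing A] (N L : Type u)
    [AddCommGroup N] [Module A N] [AddCommGroup L] [Module A L] : Prop :=
  ∃ p q : Submodule A L, IsCompl p q ∧ Nonempty (N ≃ₗ[A] p)

/-- `N` is isomorphic to a direct summand of a finitely generated `S`-module that is extended
from `R`. -/
def IsSummandOfExtended (R : Type u) [CommRing R] (S : Type u) [CommRing S] [Algebra R S]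
    (N : Type u) [AddCommGroup N] [Module S N] : Prop :=
  ∃ (L : Type u) (_ : AddCommGroup L) (_ : Module S L),
    Module.Finite S L ∧ IsExtendedModule R S L ∧ IsoToDirectSummand S N L

/-!
Everything follows from comparing two cardinalities over the completion `R̂`.

*Countably many summands.* A finite `R`-module is `Rⁿ` modulo a finitely generated submodule, so
countability of `R` leaves only countably many. By faithful flatness of `R̂`, a finite extended
module is the base change of one of these. If `L` is such a base change, then `L ⧸ 𝔪 L` is
countable since the residue field is, and two idempotent endomorphisms of `L` with the same
reduction modulo `𝔪` have isomorphic images (`nonempty_range_equiv_of_sub_mem`). So `L` has only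
countably many direct summands up to isomorphism, whether indecomposable or not.

*Uncountably many cyclic modules.* The modules `R̂ ⧸ I` with `I` proper are indecomposable because
`R̂` is local, and distinct ideals give nonisomorphic modules, as their annihilators differ. There
are uncountably many ideals (`AdicCompletion.not_countable_setOf_ne_top`): take a system of
parameters `x, y, t` of `R`, which exists with two distinguished members as the dimension is at
least `2`, and consider the ideals `(x + a y, t)` for `a = ∑ εᵢ yⁱ` with digits `εᵢ ∈ {0, 1}`.
If the ideals for two distinct digit sequences coincided, the difference of their generators would
put a power of `y` into one of them. After truncation modulo a high power of `𝔪`, Nakayama's lemma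
turns this into a statement in `R`: an ideal with `dim R - 1` generators would be `𝔪`-primary,
against Krull's height theorem (`IsLocalRing.pow_notMem_sup_maximalIdeal_pow`). Working modulo
powers of `𝔪` makes any dimension theory of `R̂` itself unnecessary.
-/

open IsLocalRing

/-! ### Ideals of the completion -/

theorem IsLocalRing.exists_maximalIdeal_pow_le_of_mem_minimalPrimes {R : Type*} [CommRing R]
    [IsLocalRing R] [IsNoetherianRing R] {I : Ideal R} (h : maximalIdeal R ∈ I.minimalPrimes) :
    ∃ K : ℕ, maximalIdeal R ^ K ≤ I := by
  have hrad : maximalIdeal R ≤ I.radical := by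
    rw [Ideal.radical_eq_sInf]
    refine le_sInf fun p hp => ?_
    have := hp.2
    exact h.2 ⟨hp.2, hp.1⟩ (le_maximalIdeal hp.2.ne_top)
  obtain ⟨K, hK⟩ := I.exists_radical_pow_le_of_fg (IsNoetherian.noetherian _)
  exact ⟨K, (Ideal.pow_right_mono hrad K).trans hK⟩

theorem Ideal.sup_span_singleton_pow_le {R : Type*} [CommRing R] (J : Ideal R) (y : R) (k : ℕ) :
    (J ⊔ Ideal.span {y}) ^ k ≤ J ⊔ Ideal.span {y ^ k} := by
  induction k with
  | zero => simp
  | succ k ih =>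
    rw [pow_succ]
    refine (Ideal.mul_mono_left ih).trans ?_
    rw [Ideal.sup_mul]
    refine sup_le (le_sup_of_le_left Ideal.mul_le_left) ?_
    rw [Ideal.mul_sup, Ideal.span_singleton_mul_span_singleton, ← pow_succ]
    exact sup_le (le_sup_of_le_left Ideal.mul_le_right) le_sup_right

/-- A system of parameters with two members `x`, `y` singled out. The containment of a power of the
maximal ideal says that `x`, `y` and `t` together generate a primary ideal. -/
theorem IsLocalRing.exists_parameters_of_two_le_ringKrullDim {R : Type*} [CommRing R]
    [IsLocalRing R] [IsNoetherianRing R] (hdim : 2 ≤ ringKrullDim R) :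
    ∃ (x y : R) (t : Finset R), x ∈ maximalIdeal R ∧ y ∈ maximalIdeal R ∧
      (t : Set R) ⊆ maximalIdeal R ∧ (t.card + 2 : ℕ∞) = (maximalIdeal R).height ∧
      ∃ K : ℕ, maximalIdeal R ^ K ≤ Ideal.span (insert x (insert y (t : Set R))) := by
  classical
  obtain ⟨s, hs, hcard⟩ :=
    (maximalIdeal R).exists_finset_card_eq_height_of_isNoetherianRing
  rw [← maximalIdeal_height_eq_ringKrullDim, ← hcard] at hdim
  have h2 : 1 < s.card := by
    have : ((2 : ℕ∞) : WithBot ℕ∞) ≤ ((s.card : ℕ∞) : WithBot ℕ∞) := hdim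
    exact_mod_cast WithBot.coe_le_coe.mp this
  obtain ⟨x, hx, y, hy, hxy⟩ := Finset.one_lt_card.mp h2
  have hsub : (s : Set R) ⊆ maximalIdeal R := Ideal.span_le.mp hs.1.2
  have hy' : y ∈ s.erase x := Finset.mem_erase.mpr ⟨hxy.symm, hy⟩
  refine ⟨x, y, (s.erase x).erase y, hsub hx, hsub hy, fun z hz => hsub ?_, ?_, ?_⟩
  · exact Finset.mem_of_mem_erase (Finset.mem_of_mem_erase hz)
  · rw [← hcard]
    have h3 := Finset.card_erase_add_one hx
    have h4 := Finset.card_erase_add_one hy'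
    norm_cast
    lia
  · obtain ⟨K, hK⟩ := exists_maximalIdeal_pow_le_of_mem_minimalPrimes hs
    refine ⟨K, ?_⟩
    rwa [← Finset.coe_insert, ← Finset.coe_insert, Finset.insert_erase hy',
      Finset.insert_erase hx]

/-- If `J = (w, t)` has fewer generators than the height of the maximal ideal, while adding `y`
makes it primary, then no power of `y` lies in `J`; this form says that this can already be seen
modulo a power of the maximal ideal which depends only on `K` and the exponent of `y`, not on `w`.
Otherwise Nakayama's lemma puts `y ^ n` into `J`, and Krull's height theorem is violated. -/
theorem IsLocalRing.pow_notMem_sup_maximalIdeal_pow {R : Type*} [CommRing R] [IsLocalRing R]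
    [IsNoetherianRing R] {y w : R} {t : Finset R} {K : ℕ} (hy : y ∈ maximalIdeal R)
    (hw : w ∈ maximalIdeal R) (ht : (t : Set R) ⊆ maximalIdeal R)
    (hheight : (t.card + 1 : ℕ∞) < (maximalIdeal R).height)
    (hK : maximalIdeal R ^ K ≤ Ideal.span (insert w (t : Set R)) ⊔ Ideal.span {y}) (n : ℕ) :
    y ^ n ∉ Ideal.span (insert w (t : Set R)) ⊔ maximalIdeal R ^ (K * (n + 1)) := by
  classical
  intro hmem
  set J := Ideal.span (insert w (t : Set R)) with hJ
  have hpow (k : ℕ) : maximalIdeal R ^ (K * k) ≤ J ⊔ Ideal.span {y ^ k} := by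
    rw [pow_mul]
    exact (Ideal.pow_right_mono hK k).trans (J.sup_span_singleton_pow_le y k)
  -- Here `y ^ n ∈ J + (y ^ (n + 1))`, and `1 - c * y` is a unit.
  have hyJ : y ^ n ∈ J := by
    obtain ⟨j, hj, b, hb, hjb⟩ := Submodule.mem_sup.mp (sup_le le_sup_left (hpow (n + 1)) hmem)
    obtain ⟨c, rfl⟩ := Ideal.mem_span_singleton'.mp hb
    have hu : IsUnit (1 - c * y) := by
      by_contra h
      exact h (isUnit_one_sub_self_of_mem_nonunits _ (Ideal.mul_mem_left _ c hy))
    refine (Ideal.unit_mul_mem_iff_mem J hu).mp ?_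
    have : (1 - c * y) * y ^ n = j := by linear_combination -hjb
    rwa [this]
  have hmJ : maximalIdeal R ^ (K * n) ≤ J :=
    (hpow n).trans (sup_le le_rfl ((Ideal.span_singleton_le_iff_mem J).mpr hyJ))
  have hmin : maximalIdeal R ∈ J.minimalPrimes := by
    refine ⟨⟨inferInstance, Ideal.span_le.mpr (Set.insert_subset hw ht)⟩, fun p hp _ => ?_⟩
    have := hp.1
    exact Ideal.IsPrime.le_of_pow_le (hmJ.trans hp.2)
  rw [hJ, ← Finset.coe_insert] at hmin
  refine absurd (Ideal.height_le_card_of_mem_minimalPrimes_span_finset hmin) (not_le.mpr ?_)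
  refine lt_of_le_of_lt ?_ hheight
  exact_mod_cast Finset.card_insert_le w t

/-- The sum of the `y ^ i` over the `i < N` with `ε i = true`: a partial sum of the power series in
`y` whose coefficients are the binary digits `ε`. -/
def binaryPartialSum {R : Type*} [CommRing R] (y : R) (ε : ℕ → Bool) (N : ℕ) : R :=
  ∑ i ∈ Finset.range N, (if ε i then 1 else 0) * y ^ i

/-- The first digit in which `ε` and `δ` differ contributes `± y ^ n` to the difference of the
partial sums, and the later ones contribute multiples of `y ^ (n + 1)`. -/
theorem exists_isUnit_binaryPartialSum_sub {R : Type*} [CommRing R] [IsLocalRing R] {y : R}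
    (hy : y ∈ maximalIdeal R) {ε δ : ℕ → Bool} {n : ℕ} (hlt : ∀ i < n, ε i = δ i)
    (hn : ε n ≠ δ n) (M : ℕ) :
    ∃ v : R, IsUnit v ∧
      binaryPartialSum y ε (n + (M + 1)) - binaryPartialSum y δ (n + (M + 1)) = v * y ^ n := by
  set d : ℕ → R := fun i => (if ε i then 1 else 0) - (if δ i then 1 else 0) with hd
  refine ⟨∑ j ∈ Finset.range M, d (n + (j + 1)) * y ^ (j + 1) + d n, ?_, ?_⟩
  · have hdn : IsUnit (d n) := by
      rcases h1 : ε n <;> rcases h2 : δ n <;> simp_all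
    have hsum : ∑ j ∈ Finset.range M, d (n + (j + 1)) * y ^ (j + 1) ∈ maximalIdeal R :=
      Ideal.sum_mem _ fun j _ => Ideal.mul_mem_left _ _ (Ideal.pow_mem_of_mem _ hy _ j.succ_pos)
    by_contra h
    exact (mem_maximalIdeal _).mp
      ((Ideal.add_mem_iff_right _ hsum).mp ((mem_maximalIdeal _).mpr h)) hdn
  · have h0 : ∑ i ∈ Finset.range n, d i * y ^ i = 0 :=
      Finset.sum_eq_zero fun i hi => by simp [hd, hlt i (Finset.mem_range.mp hi)]
    simp only [binaryPartialSum, ← Finset.sum_sub_distrib, ← sub_mul]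
    change ∑ i ∈ Finset.range (n + (M + 1)), d i * y ^ i = _
    rw [Finset.sum_range_add, h0, zero_add, Finset.sum_range_succ', add_mul, Finset.sum_mul]
    exact congrArg₂ _ (Finset.sum_congr rfl fun j _ => by ring) rfl

/-- The element `x + a y` of the `I`-adic completion, where `a` is the limit of the partial sums
`binaryPartialSum y ε N`. -/
noncomputable def binaryLift {R : Type*} [CommRing R] {I : Ideal R} (x : R) {y : R} (hy : y ∈ I)
    (ε : ℕ → Bool) : AdicCompletion I R :=
  AdicCompletion.mk I R <| AdicCompletion.AdicCauchySequence.mk I R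
    (fun N => x + binaryPartialSum y ε N * y) fun N => by
      rw [SModEq.sub_mem, binaryPartialSum, binaryPartialSum, Finset.sum_range_succ, smul_eq_mul,
        Ideal.mul_top]
      have : y ^ N ∈ I ^ N := Ideal.pow_mem_pow hy N
      rw [show x + (∑ i ∈ Finset.range N, (if ε i then 1 else 0) * y ^ i) * y -
          (x + (∑ i ∈ Finset.range N, (if ε i then 1 else 0) * y ^ i +
            (if ε N then 1 else 0) * y ^ N) * y) = -((if ε N then 1 else 0) * y) * y ^ N by ring]
      exact Ideal.mul_mem_left _ _ this

theorem evalₐ_binaryLift {R : Type*} [CommRing R] {I : Ideal R} (x : R) {y : R} (hy : y ∈ I)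
    (ε : ℕ → Bool) (N : ℕ) :
    AdicCompletion.evalₐ I N (binaryLift x hy ε) =
      Ideal.Quotient.mk (I ^ N) (x + binaryPartialSum y ε N * y) := by
  rw [binaryLift, AdicCompletion.evalₐ_mk]
  rfl

theorem map_evalₐ_span {R : Type*} [CommRing R] {I : Ideal R} (x : R) {y : R} (hy : y ∈ I)
    (ε : ℕ → Bool) (t : Set R) (N : ℕ) :
    (Ideal.span (insert (binaryLift x hy ε) (algebraMap R (AdicCompletion I R) '' t))).map
        (AdicCompletion.evalₐ I N) =
      (Ideal.span (insert (x + binaryPartialSum y ε N * y) t)).map (Ideal.Quotient.mk (I ^ N)) := by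
  rw [Ideal.map_span, Ideal.map_span, Set.image_insert_eq, Set.image_insert_eq, evalₐ_binaryLift,
    Set.image_image]
  congr 2

/-- For a system of parameters `x, y, t` of `R`, the ideals `(x + a y, t)` of the completion are
pairwise distinct as `a` runs over the power series in `y` with coefficients `0` and `1`. -/
theorem AdicCompletion.not_countable_setOf_ne_top {R : Type*} [CommRing R] [IsLocalRing R]
    [IsNoetherianRing R] (hdim : 2 ≤ ringKrullDim R) :
    ¬ {I : Ideal (AdicCompletion (maximalIdeal R) R) | I ≠ ⊤}.Countable := by
  obtain ⟨x, y, t, hx, hy, ht, hcard, K, hK⟩ := exists_parameters_of_two_le_ringKrullDim hdim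
  set F : (ℕ → Bool) → Ideal (AdicCompletion (maximalIdeal R) R) := fun ε =>
    Ideal.span (insert (binaryLift x hy ε) (algebraMap R _ '' (t : Set R))) with hF
  have hw (ε : ℕ → Bool) (N : ℕ) : x + binaryPartialSum y ε N * y ∈ maximalIdeal R :=
    add_mem hx (Ideal.mul_mem_left _ _ hy)
  have hheight : (t.card + 1 : ℕ∞) < (maximalIdeal R).height := by
    rw [← hcard]; norm_cast; lia
  have hmem {ε : ℕ → Bool} {N : ℕ} {r : R} {s : AdicCompletion (maximalIdeal R) R} (hs : s ∈ F ε)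
      (hr : AdicCompletion.evalₐ _ N s = Ideal.Quotient.mk _ r) :
      r ∈ Ideal.span (insert (x + binaryPartialSum y ε N * y) (t : Set R)) ⊔
        maximalIdeal R ^ N := by
    rw [← Ideal.mem_quotient_iff_mem_sup, ← map_evalₐ_span x hy, ← hr]
    exact Ideal.mem_map_of_mem _ hs
  have hinj : Function.Injective F := by
    intro ε δ hεδ
    by_contra hne
    -- `n` is the first index where the two sequences differ.
    have hex : ∃ n, ε n ≠ δ n := Function.ne_iff.mp hne
    classical
    obtain ⟨n, hn, hlt⟩ : ∃ n, ε n ≠ δ n ∧ ∀ i < n, ε i = δ i :=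
      ⟨Nat.find hex, Nat.find_spec hex, fun i hi => not_not.mp (Nat.find_min hex hi)⟩
    -- `M` is the precision that `pow_notMem_sup_maximalIdeal_pow` needs for `y ^ (n + 1)`.
    set M := K * (n + 2)
    set N := n + (M + 1)
    set J := Ideal.span (insert (x + binaryPartialSum y δ N * y) (t : Set R)) with hJ
    have hε : x + binaryPartialSum y ε N * y ∈ J ⊔ maximalIdeal R ^ N :=
      hmem (s := binaryLift x hy ε) (hεδ ▸ Ideal.subset_span (Set.mem_insert _ _))
        (evalₐ_binaryLift x hy ε N)
    have hδ : x + binaryPartialSum y δ N * y ∈ J := Ideal.subset_span (Set.mem_insert _ _)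
    obtain ⟨v, hv, hvy⟩ := exists_isUnit_binaryPartialSum_sub hy hlt hn M
    -- `J` contains both generators modulo `𝔪 ^ N`, hence also their difference `v * y ^ (n + 1)`.
    have hyn : y ^ (n + 1) ∈ J ⊔ maximalIdeal R ^ M := by
      refine (Ideal.unit_mul_mem_iff_mem _ hv).mp ?_
      have h := sub_mem hε (Ideal.mem_sup_left hδ)
      rw [show v * y ^ (n + 1) = x + binaryPartialSum y ε N * y -
        (x + binaryPartialSum y δ N * y) by linear_combination -y * hvy]
      exact sup_le_sup_left (Ideal.pow_le_pow_right (by lia)) J h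
    refine pow_notMem_sup_maximalIdeal_pow hy (hw δ N) ht hheight (hK.trans ?_) (n + 1) hyn
    have hyJ : y ∈ J ⊔ Ideal.span {y} := Ideal.mem_sup_right (Ideal.mem_span_singleton_self y)
    refine Ideal.span_le.mpr (Set.insert_subset ?_ (Set.insert_subset hyJ fun z hz => ?_))
    · exact (Ideal.add_mem_iff_left _ (Ideal.mul_mem_left _ _ hyJ)).mp (Ideal.mem_sup_left hδ)
    · exact Ideal.mem_sup_left (Ideal.subset_span (Set.mem_insert_of_mem _ hz))
  have htop (ε : ℕ → Bool) : F ε ≠ ⊤ := by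
    intro h
    have h1 := hmem (N := 1) (r := 1) (s := 1) (h ▸ Submodule.mem_top : 1 ∈ F ε)
      (by rw [map_one, map_one])
    rw [pow_one] at h1
    exact (Ideal.ne_top_iff_one _).mp (maximalIdeal.isMaximal R).ne_top
      (sup_le (Ideal.span_le.mpr (Set.insert_subset (hw ε 1) ht)) le_rfl h1)
  intro hc
  have : (Set.univ : Set (ℕ → Bool)).Countable :=
    Set.countable_of_injective_of_countable_image hinj.injOn
      (hc.mono (by rintro _ ⟨ε, -, rfl⟩; exact htop ε))
  have : Cardinal.mk (ℕ → Bool) ≤ Cardinal.aleph0 :=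
    Cardinal.mk_le_aleph0_iff.mpr (Set.countable_univ_iff.mp this)
  rw [← Cardinal.power_def, Cardinal.mk_bool, Cardinal.mk_nat] at this
  exact (Cardinal.cantor _).not_ge this

/-! ### Isomorphism classes of finite modules -/

theorem mk_mem_isoClassesOf {A : Type u} [CommRing A] {P : ModuleCat.{u} A → Prop}
    {N : ModuleCat.{u} A} (hN : P N) : Quotient.mk _ N ∈ isoClassesOf A P :=
  ⟨N, hN, rfl⟩

/-- A set of isomorphism classes is countable if every module in question carries a label from a
countable type and modules with a common label are isomorphic. -/
theorem countable_isoClassesOf {A : Type u} [CommRing A] {P : ModuleCat.{u} A → Prop}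
    {κ : Type*} [Countable κ] (r : κ → ModuleCat.{u} A → Prop)
    (hr : ∀ N, P N → ∃ k, r k N)
    (hiso : ∀ k N N', r k N → r k N' → Nonempty (N ≃ₗ[A] N')) :
    (isoClassesOf A P).Countable := by
  have hcov : isoClassesOf A P ⊆ ⋃ k, {c | ∃ N, r k N ∧ c = Quotient.mk _ N} := by
    rintro _ ⟨N, hN, rfl⟩
    obtain ⟨k, hk⟩ := hr N hN
    exact Set.mem_iUnion.mpr ⟨k, N, hk, rfl⟩
  refine (Set.countable_iUnion fun k => Set.Subsingleton.countable ?_).mono hcov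
  rintro _ ⟨N, hN, rfl⟩ _ ⟨N', hN', rfl⟩
  obtain ⟨e⟩ := hiso k N N' hN hN'
  exact Quotient.sound ⟨e.toModuleIso⟩

theorem isoClassesOf_mono {A : Type u} [CommRing A] {P Q : ModuleCat.{u} A → Prop}
    (h : ∀ N, P N → Q N) : isoClassesOf A P ⊆ isoClassesOf A Q := by
  rintro _ ⟨N, hN, rfl⟩
  exact ⟨N, h N hN, rfl⟩

theorem countable_fg_submodule (R M : Type*) [CommRing R] [AddCommGroup M] [Module R M]
    [Countable M] : Countable {S : Submodule R M // S.FG} := by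
  have : Function.Surjective
      (fun s : Finset M => (⟨Submodule.span R s, ⟨s, rfl⟩⟩ : {S : Submodule R M // S.FG})) := by
    rintro ⟨S, s, rfl⟩
    exact ⟨s, rfl⟩
  exact this.countable

theorem countable_isoClassesOf_finite (R : Type u) [CommRing R] [IsNoetherianRing R]
    [Countable R] : (isoClassesOf R (fun M => Module.Finite R M)).Countable := by
  have (n : ℕ) := countable_fg_submodule R (Fin n → R)
  refine countable_isoClassesOf (κ := Σ n : ℕ, {S : Submodule R (Fin n → R) // S.FG})
    (fun k N => Nonempty (((Fin k.1 → R) ⧸ k.2.1) ≃ₗ[R] N)) (fun N hN => ?_) ?_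
  · obtain ⟨n, f, hf⟩ := Module.Finite.exists_fin' R N
    exact ⟨⟨n, LinearMap.ker f, IsNoetherian.noetherian _⟩, ⟨f.quotKerEquivOfSurjective hf⟩⟩
  · rintro k N N' ⟨e⟩ ⟨e'⟩
    exact ⟨e.symm.trans e'⟩

theorem quotient_linearEquiv_eq {A : Type u} [CommRing A] {I J : Ideal A}
    (e : (A ⧸ I) ≃ₗ[A] (A ⧸ J)) : I = J := by
  rw [← Ideal.annihilator_quotient (I := I), e.annihilator_eq, Ideal.annihilator_quotient]

/-! ### Cyclic modules over a local ring -/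

theorem indecomposable_quotient {A : Type u} [CommRing A] [IsLocalRing A] {I : Ideal A}
    (hI : I ≠ ⊤) : CategoryTheory.Indecomposable (ModuleCat.of A (A ⧸ I)) := by
  refine ⟨fun h => ?_, fun Y Z i => ?_⟩
  · rw [ModuleCat.isZero_of_iff_subsingleton, Ideal.Quotient.subsingleton_iff] at h
    exact hI h
  -- The element `r` acts as `1` on the generator of `Y` and as `0` on that of `Z`. In a local ring
  -- `r` or `1 - r` is a unit, so one of the two generators vanishes.
  · let e : (A ⧸ I) ≃ₗ[A] (Y × Z) := (i.trans (ModuleCat.biprodIsoProd Y Z)).toLinearEquiv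
    let φ : A →ₗ[A] Y × Z := e.toLinearMap ∘ₗ (Submodule.mkQ I)
    have hφ : Function.Surjective φ := e.surjective.comp (Submodule.mkQ_surjective I)
    have hφ1 (a : A) : φ a = a • φ 1 := by rw [← map_smul, smul_eq_mul, mul_one]
    obtain ⟨r, hr⟩ := hφ ((φ 1).1, 0)
    rw [hφ1] at hr
    have hr1 : r • (φ 1).1 = (φ 1).1 := congrArg Prod.fst hr
    have hr2 : r • (φ 1).2 = 0 := congrArg Prod.snd hr
    rcases isUnit_or_isUnit_one_sub_self r with hu | hu
    · right
      have h0 : (φ 1).2 = 0 := hu.smul_eq_zero.mp hr2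
      rw [ModuleCat.isZero_iff_subsingleton]
      refine subsingleton_of_forall_eq 0 fun z => ?_
      obtain ⟨a, ha⟩ := hφ (0, z)
      rw [hφ1] at ha
      have : a • (φ 1).2 = z := congrArg Prod.snd ha
      rw [← this, h0, smul_zero]
    · left
      have h0 : (φ 1).1 = 0 := hu.smul_eq_zero.mp (by rw [sub_smul, one_smul, hr1, sub_self])
      rw [ModuleCat.isZero_iff_subsingleton]
      refine subsingleton_of_forall_eq 0 fun z => ?_
      obtain ⟨a, ha⟩ := hφ (z, 0)
      rw [hφ1] at ha
      have : a • (φ 1).1 = z := congrArg Prod.fst ha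
      rw [← this, h0, smul_zero]

theorem not_countable_isoClassesOf_indecomposable {A : Type u} [CommRing A] [IsLocalRing A]
    (hA : ¬ {I : Ideal A | I ≠ ⊤}.Countable) :
    ¬ (isoClassesOf A (fun N => Module.Finite A N ∧ CategoryTheory.Indecomposable N)).Countable := by
  intro hc
  refine hA (Set.MapsTo.countable_of_injOn
    (f := fun I : Ideal A => Quotient.mk _ (ModuleCat.of A (A ⧸ I))) (fun I hI => ?_)
    (fun I _ J _ h => ?_) hc)
  · exact mk_mem_isoClassesOf ⟨inferInstanceAs (Module.Finite A (A ⧸ I)),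
      indecomposable_quotient hI⟩
  · obtain ⟨e⟩ := Quotient.exact h
    exact quotient_linearEquiv_eq e.toLinearEquiv

/-! ### Direct summands of extended modules -/

theorem LinearMap.bijective_of_sub_mem_maximalIdeal_smul {A L : Type*} [CommRing A]
    [IsLocalRing A] [AddCommGroup L] [Module A L] [Module.Finite A L] (u : L →ₗ[A] L)
    (hu : ∀ x, x - u x ∈ maximalIdeal A • (⊤ : Submodule A L)) : Function.Bijective u := by
  have hsurj : Function.Surjective u := by
    rw [← LinearMap.range_eq_top, eq_top_iff]
    refine Submodule.le_of_le_smul_of_le_jacobson_bot Module.Finite.fg_top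
      (maximalIdeal_le_jacobson _) fun x _ => ?_
    rw [← add_sub_cancel (u x) x]
    exact Submodule.add_mem_sup ⟨x, rfl⟩ (hu x)
  exact ⟨OrzechProperty.injective_of_surjective_endomorphism u hsurj, hsurj⟩

/-- Idempotent endomorphisms of a finite module over a local ring that agree modulo the maximal
ideal have isomorphic images: `u = f e + (1 - f) (1 - e)` is congruent to the identity, hence an
automorphism, and it satisfies `u e = f u`. -/
theorem nonempty_range_equiv_of_sub_mem {A L : Type*} [CommRing A]
    [IsLocalRing A] [AddCommGroup L] [Module A L] [Module.Finite A L] {e f : L →ₗ[A] L}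
    (he : IsIdempotentElem e) (hf : IsIdempotentElem f)
    (hef : ∀ x, e x - f x ∈ maximalIdeal A • (⊤ : Submodule A L)) :
    Nonempty (e.range ≃ₗ[A] f.range) := by
  set u : Module.End A L := f * e + (1 - f) * (1 - e) with hu
  have hbij : Function.Bijective u := by
    refine LinearMap.bijective_of_sub_mem_maximalIdeal_smul u fun x => ?_
    -- The second summand vanishes because `e` is idempotent.
    have h1 : 1 - u = (e - f) * (2 * e - 1) + (2 * e - 2 * (e * e)) := by
      rw [hu]; noncomm_ring
    rw [he.eq, sub_self, add_zero] at h1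
    have h2 : x - u x = (e - f) ((2 * e - 1 : Module.End A L) x) := LinearMap.congr_fun h1 x
    rw [h2]
    exact hef _
  have hue : u * e = f * u := by
    rw [hu]
    have h1 : (1 - e) * e = 0 := by rw [sub_mul, he.eq, one_mul, sub_self]
    have h2 : f * (1 - f) = 0 := by rw [mul_sub, hf.eq, mul_one, sub_self]
    rw [add_mul, mul_add, mul_assoc, mul_assoc, he.eq, h1, ← mul_assoc f, ← mul_assoc f, hf.eq, h2,
      mul_zero, zero_mul]
  let U := LinearEquiv.ofBijective u hbij
  have hmap : e.range.map (U : L →ₗ[A] L) = f.range := by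
    change e.range.map u = _
    rw [← LinearMap.range_comp]
    change (u * e).range = _
    rw [hue]
    exact LinearMap.range_comp_of_range_eq_top f (LinearMap.range_eq_top.mpr hbij.2)
  exact ⟨(U.submoduleMap e.range).trans (LinearEquiv.ofEq _ _ hmap)⟩

theorem countable_quotient_maximalIdeal_smul_top (R A L : Type*) [CommRing R] [CommRing A]
    [Algebra R A] [IsLocalRing A] [Countable R]
    (hRA : Function.Surjective (algebraMap R (ResidueField A)))
    [AddCommGroup L] [Module A L] [Module.Finite A L] :
    Countable (L ⧸ maximalIdeal A • (⊤ : Submodule A L)) := by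
  obtain ⟨n, g, hg⟩ := Module.Finite.exists_fin' A L
  have : Function.Surjective (fun r : Fin n → R =>
      Submodule.Quotient.mk (p := maximalIdeal A • (⊤ : Submodule A L))
        (g fun i => algebraMap R A (r i))) := by
    intro z
    obtain ⟨x, rfl⟩ := Submodule.Quotient.mk_surjective _ z
    obtain ⟨a, rfl⟩ := hg x
    choose r hr using fun i => hRA (residue A (a i))
    refine ⟨r, (Submodule.Quotient.eq _).mpr ?_⟩
    rw [← map_sub, pi_eq_sum_univ' ((fun i => algebraMap R A (r i)) - a), map_sum]
    refine Submodule.sum_mem _ fun i _ => ?_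
    rw [map_smul]
    refine Submodule.smul_mem_smul ?_ Submodule.mem_top
    rw [← residue_eq_zero_iff, Pi.sub_apply, map_sub, ← hr i, sub_eq_zero]
    rfl
  exact this.countable

theorem AdicCompletion.algebraMap_residueField_surjective (R : Type*) [CommRing R] [IsLocalRing R]
    [IsNoetherianRing R] : Function.Surjective
      (algebraMap R (ResidueField (AdicCompletion (maximalIdeal R) R))) := by
  intro z
  obtain ⟨s, rfl⟩ := residue_surjective z
  obtain ⟨r, hr⟩ := Ideal.Quotient.mk_surjective (AdicCompletion.evalOneₐ (maximalIdeal R) s)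
  refine ⟨r, ?_⟩
  change residue _ (algebraMap R _ r) = _
  rw [← sub_eq_zero, ← map_sub, residue_eq_zero_iff, maximalIdeal_eq_map,
    ← AdicCompletion.ker_evalOneₐ_eq_map _ (maximalIdeal R).fg_of_isNoetherianRing,
    RingHom.mem_ker, map_sub, sub_eq_zero]
  exact ((AdicCompletion.evalOneₐ (maximalIdeal R)).commutes r).trans hr

/-- A direct summand of `L` is determined up to isomorphism by the reduction modulo the maximal
ideal of a projection onto it, and this reduction is given by finitely many values in `L ⧸ 𝔪 L`. -/
theorem countable_isoClassesOf_isoToDirectSummand (A : Type u) [CommRing A] [IsLocalRing A]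
    (L : Type u) [AddCommGroup L] [Module A L] [Module.Finite A L]
    [Countable (L ⧸ maximalIdeal A • (⊤ : Submodule A L))] :
    (isoClassesOf A (fun N => IsoToDirectSummand A N L)).Countable := by
  obtain ⟨n, g, hg⟩ := Module.Finite.exists_fin' A L
  let π := (maximalIdeal A • (⊤ : Submodule A L)).mkQ
  refine countable_isoClassesOf
    (κ := Fin n → L ⧸ maximalIdeal A • (⊤ : Submodule A L))
    (fun k N => ∃ e : Module.End A L, IsIdempotentElem e ∧ Nonempty (N ≃ₗ[A] e.range) ∧
      k = fun i => π (e (g (Pi.single i 1)))) ?_ ?_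
  · rintro N ⟨p, q, hpq, ⟨i⟩⟩
    exact ⟨_, p.projection q hpq, Submodule.isIdempotentElem_projection hpq,
      ⟨i.trans (LinearEquiv.ofEq _ _ (Submodule.range_projection hpq).symm)⟩, rfl⟩
  · rintro k N N' ⟨e, he, ⟨i⟩, rfl⟩ ⟨f, hf, ⟨j⟩, hk⟩
    have hπ : π ∘ₗ e ∘ₗ g = π ∘ₗ f ∘ₗ g := (Pi.basisFun A (Fin n)).ext fun i => by
      simpa using congrFun hk i
    obtain ⟨m⟩ := nonempty_range_equiv_of_sub_mem he hf fun x => by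
      obtain ⟨a, rfl⟩ := hg x
      exact (Submodule.Quotient.eq _).mp (LinearMap.congr_fun hπ a)
    exact ⟨i.trans (m.trans j.symm)⟩

/-- By faithful flatness, a finite extended module is the base change of a finite `R`-module, so it
is one of countably many modules up to isomorphism, each of which has countably many summands. -/
theorem countable_isoClassesOf_isSummandOfExtended (R : Type u) [CommRing R] [IsLocalRing R]
    [IsNoetherianRing R] [Countable R] :
    (isoClassesOf (AdicCompletion (maximalIdeal R) R)
      (fun N => IsSummandOfExtended R (AdicCompletion (maximalIdeal R) R) N)).Countable := by
  set S := AdicCompletion (maximalIdeal R) R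
  have (n : ℕ) := countable_fg_submodule R (Fin n → R)
  have hcount (n : ℕ) (U : Submodule R (Fin n → R)) :
      (isoClassesOf S fun N => IsoToDirectSummand S N
        (TensorProduct R S ((Fin n → R) ⧸ U))).Countable := by
    have := countable_quotient_maximalIdeal_smul_top R S (TensorProduct R S ((Fin n → R) ⧸ U))
      (AdicCompletion.algebraMap_residueField_surjective R)
    exact countable_isoClassesOf_isoToDirectSummand S _
  refine (Set.countable_iUnion fun k : Σ n : ℕ, {U : Submodule R (Fin n → R) // U.FG} =>
    hcount k.1 k.2.1).mono ?_
  rintro _ ⟨N, ⟨L, _, _, _, ⟨M, _, _, ⟨i⟩⟩, p, q, hpq, ⟨j⟩⟩, rfl⟩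
  have : Module.FaithfullyFlat R S := Module.FaithfullyFlat.of_flat_of_isLocalHom
  have : Module.Finite S (TensorProduct R S M) := Module.Finite.equiv i.symm
  have : Module.Finite R M := Module.Finite.of_finite_tensorProduct_of_faithfullyFlat S
  obtain ⟨n, f, hf⟩ := Module.Finite.exists_fin' R M
  refine Set.mem_iUnion.mpr ⟨⟨n, LinearMap.ker f, IsNoetherian.noetherian _⟩, N, ?_, rfl⟩
  let l : L ≃ₗ[S] TensorProduct R S ((Fin n → R) ⧸ LinearMap.ker f) :=
    i.symm.trans ((f.quotKerEquivOfSurjective hf).symm.baseChange R S _ _)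
  exact ⟨_, _, (Submodule.orderIsoMapComap l).isCompl hpq, ⟨j.trans (l.submoduleMap p)⟩⟩

theorem mainTheorem8 (R : Type u) [CommRing R] [IsLocalRing R] [IsNoetherianRing R]
    [Countable R] (hdim : 2 ≤ ringKrullDim R) :
    (isoClassesOf R (fun M => Module.Finite R M)).Countable ∧
    ¬ (isoClassesOf (AdicCompletion (IsLocalRing.maximalIdeal R) R)
        (fun N => Module.Finite (AdicCompletion (IsLocalRing.maximalIdeal R) R) N ∧
          CategoryTheory.Indecomposable N)).Countable ∧
    (isoClassesOf (AdicCompletion (IsLocalRing.maximalIdeal R) R)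
        (fun N => CategoryTheory.Indecomposable N ∧
          IsSummandOfExtended R (AdicCompletion (IsLocalRing.maximalIdeal R) R) N)).Countable ∧
    ∃ N : ModuleCat.{u} (AdicCompletion (IsLocalRing.maximalIdeal R) R),
      Module.Finite (AdicCompletion (IsLocalRing.maximalIdeal R) R) N ∧
      ¬ IsSummandOfExtended R (AdicCompletion (IsLocalRing.maximalIdeal R) R) N := by
  have huncount := not_countable_isoClassesOf_indecomposable
    (AdicCompletion.not_countable_setOf_ne_top hdim)
  have hcount := countable_isoClassesOf_isSummandOfExtended R
  refine ⟨countable_isoClassesOf_finite R, huncount,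
    hcount.mono (isoClassesOf_mono fun N hN => hN.2), ?_⟩
  by_contra! h
  exact huncount (hcount.mono (isoClassesOf_mono fun N hN => h N hN.1))
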